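/- Let $N=3$, $p>5$, $\lambda>0$ and $b>0$, and put $$C_p=\frac{2\sqrt{2(p-5)}}{p+3}+\arccos\left(-\sqrt{\frac{p-5}{p+3}}\right).$$ Let $B(b)=\{x\in\mathbb{R}^3:|x|<b\}$ and let $\lambda_1(B(b))$ be the first Dirichlet eigenvalue of $-\Delta$ on $B(b)$, that is, the least $\mu\in\mathbb{R}$ for which $-\Delta\phi=\mu\phi$ in $B(b)$, $\phi=0$ on $\partial B(b)$, has a solution $\phi\not\equiv0$ in $C^2(B(b))\cap C(\overline{B(b)})$; this least value exists. If the problem $$u''+\frac{2}{r}u'+\lambda u+u^p=0\quad (0<r<b),\qquad u'(0)=u(b)=0,$$ has a positive solution, i.e. a solution $u\in C([0,b])\cap C^2((0,b))$ with $u>0$ on $(0,b)$, the derivative at $0$ being one-sided, then $$\frac{C_p}{\sqrt\lambda}<b<\frac{\pi}{\sqrt\lambda}\qquad\text{and}\qquad \frac{C_p^2}{\pi^2}\,\lambda_1(B(b))<\lambda<\lambda_1(B(b)).$$ Moreover, for all $p>5$, $\lambda>0$ and $b>0$, these two chains of inequalities are equivalent to each other. -/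

import Mathlib

/-- `u` is a positive (classical) solution of the problem on the ball of radius `b` in `ℝ^N`:
`u'' + ((N - 1) / r) u' + lam u + u ^ p = 0` for `0 < r < b`, with `u'(0) = u(b) = 0`.
The derivative at the endpoint `0` is the one-sided one. -/
structure IsPositiveBallSolution (N : ℕ) (p lam b : ℝ) (u : ℝ → ℝ) : Prop where
  continuousOn : ContinuousOn u (Set.Icc 0 b)
  contDiffOn : ContDiffOn ℝ 2 u (Set.Ioo 0 b)
  equation : ∀ r ∈ Set.Ioo (0 : ℝ) b,
    deriv (deriv u) r + ((N : ℝ) - 1) / r * deriv u r + lam * u r + u r ^ p = 0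
  deriv_zero : HasDerivWithinAt u 0 (Set.Icc 0 b) 0
  boundary : u b = 0
  pos : ∀ r ∈ Set.Ioo (0 : ℝ) b, 0 < u r

/-- The set of real numbers `mu` for which the Dirichlet problem `-Δ φ = mu φ` in
`B(b) = {x ∈ ℝ^N : |x| < b}`, `φ = 0` on `∂B(b)`, has a nontrivial classical solution
`φ ∈ C²(B(b)) ∩ C(closure B(b))`. -/
def dirichletBallEigenvalues (N : ℕ) (b : ℝ) : Set ℝ :=
  {mu : ℝ | ∃ φ : EuclideanSpace ℝ (Fin N) → ℝ,
    ContDiffOn ℝ 2 φ (Metric.ball 0 b) ∧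
    ContinuousOn φ (Metric.closedBall 0 b) ∧
    (∀ x ∈ Metric.ball (0 : EuclideanSpace ℝ (Fin N)) b,
      -(Laplacian.laplacian φ x) = mu * φ x) ∧
    (∀ x ∈ Metric.sphere (0 : EuclideanSpace ℝ (Fin N)) b, φ x = 0) ∧
    (∃ x ∈ Metric.ball (0 : EuclideanSpace ℝ (Fin N)) b, φ x ≠ 0)}

/-- The first Dirichlet eigenvalue `λ₁(B(b))` of `-Δ` on the ball of radius `b` in `ℝ^N`. -/
noncomputable def firstDirichletEigenvalue (N : ℕ) (b : ℝ) : ℝ :=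
  sInf (dirichletBallEigenvalues N b)

/-- The constant `2 √(2 (p - 5)) / (p + 3) + arccos (-√((p - 5) / (p + 3)))`. -/
noncomputable def ballConstant (p : ℝ) : ℝ :=
  2 * √(2 * (p - 5)) / (p + 3) + Real.arccos (-√((p - 5) / (p + 3)))

open Filter Topology Set

/-! In dimension three `v = r u` satisfies `v'' + lam v + r u ^ p = 0`, without a first-order term.
Upper bound: if `√lam * b ≥ π`, the Wronskian of `v` with `sin (π r / b)` strictly decreases
although it vanishes at both ends (`mul_lt_pi`).

Lower bound: a Pohozaev functional with multiplier `φ`, `φ''' + 4 lam φ' = 0`, has a derivative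
containing only `u ^ (p + 1)`, with a weight depending on `φ` (`hasDerivAt_pohozaev`). Take `φ = cos
d - cos (2 √lam r + d)` with `cos² β = (p - 5) / (p + 3)` and `d = β - sin β cos β`; then the
constant is `π - d`. If `√lam * b ≤ π - d`, then `φ ≥ 0`, and `two_mul_mul_sin_lt` makes the
functional strictly decreasing. It starts at `0` and its boundary value at `b` cannot be negative, a
contradiction.

The eigenvalue form follows from `λ₁ = (π / b) ^ 2`: `sin (κ |x|) / (κ |x|)` is an eigenfunction for
`κ = π / b` and, for smaller `κ`, a positive comparison function. -/

/-! ### The entire function `sin √s / √s` -/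

/-- The entire function `G` with `x * G (x ^ 2) = sin x`. -/
noncomputable def sincSqrt : ℝ → ℝ :=
  FormalMultilinearSeries.ofScalarsSum (E := ℝ) fun n : ℕ => (-1 : ℝ) ^ n / ((2 * n + 1).factorial : ℝ)

theorem mul_sincSqrt_sq (x : ℝ) : x * sincSqrt (x ^ 2) = Real.sin x := by
  rw [Real.sin_eq_tsum, sincSqrt, FormalMultilinearSeries.ofScalarsSum_eq_tsum, ← tsum_mul_left]
  refine tsum_congr fun n => ?_
  rw [smul_eq_mul, ← pow_mul]
  ring

theorem contDiff_sincSqrt {n : WithTop ℕ∞} : ContDiff ℝ n sincSqrt := by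
  set c : ℕ → ℝ := fun n => (-1 : ℝ) ^ n / ((2 * n + 1).factorial : ℝ) with hc
  have hrad : (FormalMultilinearSeries.ofScalars ℝ c).radius = ⊤ := by
    refine FormalMultilinearSeries.ofScalars_radius_eq_top_of_tendsto ℝ c
      (Eventually.of_forall fun n => div_ne_zero (pow_ne_zero _ (by norm_num)) (by positivity)) ?_
    have hle : ∀ n : ℕ, ‖c n.succ‖ / ‖c n‖ ≤ 1 / ((n : ℝ) + 1) := by
      intro n
      have h1 : ((2 * (n + 1) + 1).factorial : ℝ) =
          (2 * n + 3) * ((2 * n + 2) * ((2 * n + 1).factorial : ℝ)) := by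
        rw [show 2 * (n + 1) + 1 = (2 * n + 1) + 1 + 1 by ring, Nat.factorial_succ,
          Nat.factorial_succ]
        push_cast
        ring
      have h2 : (0 : ℝ) < ((2 * n + 1).factorial : ℝ) := by positivity
      simp only [hc, Nat.succ_eq_add_one, norm_div, norm_pow, norm_neg, norm_one, one_pow,
        RCLike.norm_natCast, h1]
      rw [Real.norm_of_nonneg (by positivity), div_div_div_eq, one_mul, mul_one, div_le_div_iff₀ (by positivity) (by positivity)]
      have h3 : (0 : ℝ) ≤ n := n.cast_nonneg
      nlinarith [mul_nonneg h2.le h3, mul_nonneg (mul_nonneg h2.le h3) h3]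
    exact squeeze_zero (fun n => by positivity) hle tendsto_one_div_add_atTop_nhds_zero_nat
  have hball : HasFPowerSeriesOnBall sincSqrt (FormalMultilinearSeries.ofScalars ℝ c) 0 ⊤ := by
    rw [← hrad]
    exact FormalMultilinearSeries.hasFPowerSeriesOnBall _ (by rw [hrad]; exact ENNReal.zero_lt_top)
  have han : AnalyticOnNhd ℝ sincSqrt univ := by
    simpa using hball.analyticOnNhd
  exact contDiffOn_univ.1 (han.contDiffOn uniqueDiffOn_univ)

theorem hasDerivAt_sincSqrt (s : ℝ) : HasDerivAt sincSqrt (deriv sincSqrt s) s :=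
  ((contDiff_sincSqrt (n := 1)).differentiable (by norm_num) s).hasDerivAt

theorem contDiff_deriv_sincSqrt {n : ℕ} : ContDiff ℝ n (deriv sincSqrt) :=
  (contDiff_succ_iff_deriv.1 (contDiff_sincSqrt (n := (n : WithTop ℕ∞) + 1))).2.2

theorem hasDerivAt_deriv_sincSqrt (s : ℝ) :
    HasDerivAt (deriv sincSqrt) (deriv (deriv sincSqrt) s) s :=
  ((contDiff_deriv_sincSqrt (n := 1)).differentiable (by norm_num) s).hasDerivAt

theorem continuous_deriv_deriv_sincSqrt : Continuous (deriv (deriv sincSqrt)) :=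
  (contDiff_deriv_sincSqrt (n := 1)).continuous_deriv (by norm_num)

/-- The differential equation of `sincSqrt`. -/
theorem sincSqrt_equation {s : ℝ} (hs : 0 ≤ s) :
    4 * s * deriv (deriv sincSqrt) s + 6 * deriv sincSqrt s + sincSqrt s = 0 := by
  have hsq : ∀ x : ℝ, HasDerivAt (fun y : ℝ => y ^ 2) (2 * x) x := fun x => by
    simpa using hasDerivAt_pow 2 x
  have h1 : ∀ x : ℝ, sincSqrt (x ^ 2) + x * (deriv sincSqrt (x ^ 2) * (2 * x)) = Real.cos x := by
    intro x
    have h := (hasDerivAt_id x).mul ((hasDerivAt_sincSqrt (x ^ 2)).comp x (hsq x))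
    have h' : (id * (sincSqrt ∘ fun y : ℝ => y ^ 2)) = Real.sin := by
      ext y
      simpa using mul_sincSqrt_sq y
    rw [h'] at h
    simpa using h.unique (Real.hasDerivAt_sin x)
  -- Differentiating `x G(x²) = sin x` twice gives `x` times the equation; continuity then recovers
  -- it at `x = 0`.
  have h2 : ∀ x : ℝ, x * (4 * x ^ 2 * deriv (deriv sincSqrt) (x ^ 2) + 6 * deriv sincSqrt (x ^ 2)
      + sincSqrt (x ^ 2)) = 0 := by
    intro x
    have h := ((hasDerivAt_sincSqrt (x ^ 2)).comp x (hsq x)).add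
      ((hasDerivAt_id x).mul (((hasDerivAt_deriv_sincSqrt (x ^ 2)).comp x (hsq x)).mul
        ((hasDerivAt_id x).const_mul 2)))
    have h' : ((sincSqrt ∘ fun y : ℝ => y ^ 2) +
        id * ((deriv sincSqrt ∘ fun y : ℝ => y ^ 2) * fun y => 2 * id y)) = Real.cos := by
      ext y
      simpa using h1 y
    rw [h'] at h
    have h3 := h.unique (Real.hasDerivAt_cos x)
    have h4 := mul_sincSqrt_sq x
    simp at h3
    linear_combination h3 + h4
  have hcont : Continuous fun x : ℝ => 4 * x ^ 2 * deriv (deriv sincSqrt) (x ^ 2)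
      + 6 * deriv sincSqrt (x ^ 2) + sincSqrt (x ^ 2) := by
    have := continuous_deriv_deriv_sincSqrt
    have := (contDiff_deriv_sincSqrt (n := 1)).continuous
    have := (contDiff_sincSqrt (n := 1)).continuous
    fun_prop
  have hzero := hcont.ext_on (dense_compl_singleton (0 : ℝ)) continuous_const
    (fun x hx => (mul_eq_zero.1 (h2 x)).resolve_left hx)
  have := congrFun hzero (√s)
  simpa [Real.sq_sqrt hs] using this

theorem sincSqrt_zero : sincSqrt 0 = 1 := by
  simp [sincSqrt, FormalMultilinearSeries.ofScalarsSum_zero]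

theorem sincSqrt_sq_pos {x : ℝ} (h0 : 0 ≤ x) (hx : x < Real.pi) : 0 < sincSqrt (x ^ 2) := by
  rcases h0.eq_or_lt with rfl | h
  · simp [sincSqrt_zero]
  · exact pos_of_mul_pos_right (by rw [mul_sincSqrt_sq]; exact Real.sin_pos_of_pos_of_lt_pi h hx) h0

/-! ### Sign of the Laplacian at a local minimum -/

section Laplacian

variable {E : Type*} [NormedAddCommGroup E] [InnerProductSpace ℝ E]

theorem iteratedFDeriv_two_eq_deriv_deriv_line {f : E → ℝ} {x : E} (hf : ContDiffAt ℝ 2 f x)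
    (v : E) :
    iteratedFDeriv ℝ 2 f x ![v, v] = deriv (deriv fun t : ℝ => f (x + t • v)) 0 := by
  have hline : ∀ t : ℝ, HasDerivAt (fun t : ℝ => x + t • v) v t := fun t => by
    simpa using ((hasDerivAt_id t).smul_const v).const_add x
  have hx0 : x + (0 : ℝ) • v = x := by simp
  have hc : Tendsto (fun t : ℝ => x + t • v) (𝓝 0) (𝓝 x) := by
    have := (hline 0).continuousAt.tendsto
    rwa [hx0] at this
  have hev : ∀ᶠ y in 𝓝 x, DifferentiableAt ℝ f y :=
    (hf.eventually (by norm_num)).mono fun y hy => hy.differentiableAt (by norm_num)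
  have h1 : deriv (fun t : ℝ => f (x + t • v)) =ᶠ[𝓝 0] fun t => fderiv ℝ f (x + t • v) v := by
    filter_upwards [hc.eventually hev] with t ht
    exact (ht.hasFDerivAt.comp_hasDerivAt t (hline t)).deriv
  rw [h1.deriv_eq, iteratedFDeriv_two_apply]
  have h2 : DifferentiableAt ℝ (fderiv ℝ f) x :=
    (hf.fderiv_right (m := 1) (by norm_num)).differentiableAt (by norm_num)
  have h3 : HasDerivAt (fun t : ℝ => fderiv ℝ f (x + t • v)) (fderiv ℝ (fderiv ℝ f) x v) 0 :=
    h2.hasFDerivAt.comp_hasDerivAt_of_eq (0 : ℝ) (hline 0) hx0.symm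
  have h4 : HasDerivAt (fun t : ℝ => fderiv ℝ f (x + t • v) v)
      (fderiv ℝ (fderiv ℝ f) x v v) 0 := by
    simpa using h3.clm_apply (hasDerivAt_const (0 : ℝ) v)
  simpa using h4.deriv.symm

theorem deriv_deriv_nonneg_of_isLocalMin {g : ℝ → ℝ} {a : ℝ} (hg : IsLocalMin g a)
    (hc : ContinuousAt g a) : 0 ≤ deriv (deriv g) a := by
  by_contra! hneg
  -- A negative second derivative makes the point a local maximum too, so `g` is locally constant.
  have hmax := isLocalMax_of_deriv_deriv_neg hneg hg.deriv_eq_zero hc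
  have hconst : g =ᶠ[𝓝 a] fun _ => g a := by
    filter_upwards [hg, hmax] with t h1 h2 using le_antisymm h2 h1
  have h1 : deriv g =ᶠ[𝓝 a] fun _ => 0 := by
    simpa using hconst.deriv
  simp [h1.deriv_eq] at hneg

theorem laplacian_nonneg_of_isLocalMin [FiniteDimensional ℝ E] {f : E → ℝ} {x : E}
    (hf : ContDiffAt ℝ 2 f x) (hx : IsLocalMin f x) : 0 ≤ Laplacian.laplacian f x := by
  rw [InnerProductSpace.laplacian_eq_iteratedFDeriv_stdOrthonormalBasis]
  refine Finset.sum_nonneg fun i _ => ?_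
  rw [iteratedFDeriv_two_eq_deriv_deriv_line hf]
  set v := stdOrthonormalBasis ℝ E i
  have hc : Continuous fun t : ℝ => x + t • v := by fun_prop
  have hx0 : x + (0 : ℝ) • v = x := by simp
  have ht : Tendsto (fun t : ℝ => x + t • v) (𝓝 0) (𝓝 x) := by
    simpa using hc.tendsto 0
  refine deriv_deriv_nonneg_of_isLocalMin ?_ ?_
  · filter_upwards [ht.eventually hx] with t h
    rwa [hx0]
  · exact ContinuousAt.comp (f := fun t : ℝ => x + t • v) (by rw [hx0]; exact hf.continuousAt)
      hc.continuousAt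

end Laplacian

/-! ### First Dirichlet eigenvalue of the ball in `ℝ³` -/

/-- The radial function `x ↦ sin (κ |x|) / (κ |x|)`. -/
noncomputable def radialSinc (κ : ℝ) (x : EuclideanSpace ℝ (Fin 3)) : ℝ :=
  sincSqrt ((κ * ‖x‖) ^ 2)

theorem contDiff_radialSinc {κ : ℝ} {n : WithTop ℕ∞} : ContDiff ℝ n (radialSinc κ) := by
  have h : ContDiff ℝ n fun x : EuclideanSpace ℝ (Fin 3) => κ ^ 2 * ‖x‖ ^ 2 :=
    contDiff_const.mul (contDiff_norm_sq ℝ)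
  have h' : radialSinc κ = sincSqrt ∘ fun x => κ ^ 2 * ‖x‖ ^ 2 := by
    ext x
    simp [radialSinc, mul_pow]
  rw [h']
  exact contDiff_sincSqrt.comp h

theorem laplacian_radialSinc (κ : ℝ) (x : EuclideanSpace ℝ (Fin 3)) :
    Laplacian.laplacian (radialSinc κ) x = -κ ^ 2 * radialSinc κ x := by
  rw [InnerProductSpace.laplacian_eq_iteratedFDeriv_orthonormalBasis _
    (EuclideanSpace.basisFun (Fin 3) ℝ)]
  have key : ∀ i, iteratedFDeriv ℝ 2 (radialSinc κ) x
      ![EuclideanSpace.basisFun (Fin 3) ℝ i, EuclideanSpace.basisFun (Fin 3) ℝ i] =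
      deriv (deriv sincSqrt) ((κ * ‖x‖) ^ 2) * (2 * κ ^ 2 * x i) ^ 2 +
        deriv sincSqrt ((κ * ‖x‖) ^ 2) * (2 * κ ^ 2) := by
    intro i
    rw [iteratedFDeriv_two_eq_deriv_deriv_line contDiff_radialSinc.contDiffAt]
    set P : ℝ → ℝ := fun t => (κ * ‖x‖) ^ 2 + κ ^ 2 * (2 * x i * t + t ^ 2) with hP
    have hP' : ∀ t, HasDerivAt P (κ ^ 2 * (2 * x i + 2 * t)) t := fun t => by
      have := ((((hasDerivAt_id t).const_mul (2 * x i)).add (hasDerivAt_pow 2 t)).const_mul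
        (κ ^ 2)).const_add ((κ * ‖x‖) ^ 2)
      simpa [hP] using this
    have hline : (fun t : ℝ => radialSinc κ (x + t • EuclideanSpace.basisFun (Fin 3) ℝ i)) =
        fun t => sincSqrt (P t) := by
      ext t
      rw [radialSinc, mul_pow, norm_add_sq_real, hP]
      congr 1
      simp [inner_smul_right, norm_smul, EuclideanSpace.inner_single_right]
      ring
    have hd : deriv (fun t => sincSqrt (P t)) =
        fun t => deriv sincSqrt (P t) * (κ ^ 2 * (2 * x i + 2 * t)) := by
      ext t
      exact ((hasDerivAt_sincSqrt (P t)).comp t (hP' t)).deriv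
    rw [hline, hd]
    have h2 := ((hasDerivAt_deriv_sincSqrt (P 0)).comp 0 (hP' 0)).mul
      ((((hasDerivAt_id (0 : ℝ)).const_mul 2).const_add (2 * x i)).const_mul (κ ^ 2))
    have hP0 : P 0 = (κ * ‖x‖) ^ 2 := by simp [hP]
    refine (h2.deriv.trans ?_)
    simp only [Function.comp_apply, hP0, id]
    ring
  simp only [key, Fin.sum_univ_three]
  have hn : ‖x‖ ^ 2 = x 0 ^ 2 + x 1 ^ 2 + x 2 ^ 2 := by
    rw [EuclideanSpace.real_norm_sq_eq, Fin.sum_univ_three]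
  have hode := sincSqrt_equation (sq_nonneg (κ * ‖x‖))
  rw [radialSinc]
  have : (κ * ‖x‖) ^ 2 = κ ^ 2 * (x 0 ^ 2 + x 1 ^ 2 + x 2 ^ 2) := by rw [mul_pow, hn]
  rw [this] at hode ⊢
  linear_combination κ ^ 2 * hode

theorem radialSinc_pos {κ : ℝ} {x : EuclideanSpace ℝ (Fin 3)} (hκ : 0 ≤ κ)
    (h : κ * ‖x‖ < Real.pi) : 0 < radialSinc κ x :=
  sincSqrt_sq_pos (by positivity) h

theorem pi_div_sq_mem_dirichletBallEigenvalues {b : ℝ} (hb : 0 < b) :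
    (Real.pi / b) ^ 2 ∈ dirichletBallEigenvalues 3 b := by
  refine ⟨radialSinc (Real.pi / b), contDiff_radialSinc.contDiffOn,
    (contDiff_radialSinc (n := 0)).continuous.continuousOn, fun x _ => ?_, fun x hx => ?_, 0, ?_, ?_⟩
  · rw [laplacian_radialSinc]
    ring
  · rw [mem_sphere_zero_iff_norm] at hx
    rw [radialSinc, hx, div_mul_cancel₀ _ hb.ne']
    simpa [Real.pi_ne_zero] using mul_sincSqrt_sq Real.pi
  · simpa using hb
  · exact (radialSinc_pos (by positivity) (by simpa using Real.pi_pos)).ne'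

/-- Maximum principle for the quotient `φ / ψ`, `ψ = radialSinc κ`: if `M` is its positive maximum,
`M ψ - φ` has an interior minimum with value `0`, where its Laplacian is `(mu - κ²) M ψ < 0`. -/
theorem pi_div_sq_le_of_mem_dirichletBallEigenvalues {b mu : ℝ} (hb : 0 < b)
    (hmu : mu ∈ dirichletBallEigenvalues 3 b) : (Real.pi / b) ^ 2 ≤ mu := by
  obtain ⟨φ₀, hC₀, hcont₀, heq₀, hbd₀, y, hy, hy₀⟩ := hmu
  obtain ⟨φ, hC, hcont, heq, hbd, hpos⟩ : ∃ φ : EuclideanSpace ℝ (Fin 3) → ℝ,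
      ContDiffOn ℝ 2 φ (Metric.ball 0 b) ∧ ContinuousOn φ (Metric.closedBall 0 b) ∧
      (∀ x ∈ Metric.ball (0 : EuclideanSpace ℝ (Fin 3)) b,
        -(Laplacian.laplacian φ x) = mu * φ x) ∧
      (∀ x ∈ Metric.sphere (0 : EuclideanSpace ℝ (Fin 3)) b, φ x = 0) ∧ 0 < φ y := by
    rcases hy₀.lt_or_gt with h | h
    · refine ⟨-φ₀, hC₀.neg, hcont₀.neg, fun x hx => ?_, fun x hx => ?_, by simpa using h⟩
      · rw [InnerProductSpace.laplacian_neg]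
        have := heq₀ x hx
        simp only [Pi.neg_apply]
        linarith
      · simp [hbd₀ x hx]
    · exact ⟨φ₀, hC₀, hcont₀, heq₀, hbd₀, h⟩
  by_contra! hlt
  -- Taking `κ` strictly below `π / b` keeps `ψ` positive up to the sphere, so the quotient is
  -- continuous on the closed ball.
  obtain ⟨κ, hκ0, hκb, hκmu⟩ : ∃ κ : ℝ, 0 ≤ κ ∧ κ * b < Real.pi ∧ mu < κ ^ 2 := by
    have hpb : 0 < Real.pi / b := by positivity
    have h1 : ∀ᶠ κ in 𝓝[<] (Real.pi / b), mu < κ ^ 2 :=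
      ((continuous_pow 2).tendsto (Real.pi / b)).mono_left nhdsWithin_le_nhds
        |>.eventually (lt_mem_nhds hlt)
    have h2 : ∀ᶠ κ in 𝓝[<] (Real.pi / b), κ ∈ Ioo 0 (Real.pi / b) := Ioo_mem_nhdsLT hpb
    obtain ⟨κ, h, h'⟩ := (h1.and h2).exists
    exact ⟨κ, h'.1.le, (lt_div_iff₀ hb).1 h'.2, h⟩
  have hψpos : ∀ x ∈ Metric.closedBall (0 : EuclideanSpace ℝ (Fin 3)) b, 0 < radialSinc κ x := by
    intro x hx
    rw [mem_closedBall_zero_iff] at hx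
    exact radialSinc_pos hκ0 ((mul_le_mul_of_nonneg_left hx hκ0).trans_lt hκb)
  have hψc : Continuous (radialSinc κ) := (contDiff_radialSinc (n := 0)).continuous
  obtain ⟨z, hz, hmax⟩ := (isCompact_closedBall (0 : EuclideanSpace ℝ (Fin 3)) b).exists_isMaxOn
    ⟨y, Metric.ball_subset_closedBall hy⟩
    (hcont.div hψc.continuousOn fun x hx => (hψpos x hx).ne')
  set M := φ z / radialSinc κ z with hM
  have hMpos : 0 < M := lt_of_lt_of_le
    (div_pos hpos (hψpos y (Metric.ball_subset_closedBall hy)))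
    (hmax (Metric.ball_subset_closedBall hy))
  have hφz : φ z = M * radialSinc κ z := by
    rw [hM, div_mul_cancel₀ _ (hψpos z hz).ne']
  have hzball : z ∈ Metric.ball (0 : EuclideanSpace ℝ (Fin 3)) b := by
    rw [mem_closedBall_zero_iff] at hz
    rw [mem_ball_zero_iff]
    refine hz.lt_of_ne fun h => ?_
    rw [hM, hbd z (by rwa [mem_sphere_zero_iff_norm]), zero_div] at hMpos
    exact hMpos.false
  have hnhds := Metric.isOpen_ball.mem_nhds hzball
  have hφz2 : ContDiffAt ℝ 2 φ z := hC.contDiffAt hnhds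
  have hψ2 : ContDiffAt ℝ 2 (M • radialSinc κ) z := contDiff_radialSinc.contDiffAt.const_smul M
  have hmin : IsLocalMin (M • radialSinc κ - φ) z := by
    filter_upwards [hnhds] with x hx
    have hx' := Metric.ball_subset_closedBall hx
    have : φ x / radialSinc κ x ≤ M := hmax hx'
    rw [div_le_iff₀ (hψpos x hx')] at this
    simp only [Pi.sub_apply, Pi.smul_apply, smul_eq_mul]
    linarith
  have hlap : 0 ≤ Laplacian.laplacian (M • radialSinc κ - φ) z :=
    laplacian_nonneg_of_isLocalMin (hψ2.sub hφz2) hmin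
  rw [hψ2.laplacian_sub hφz2, InnerProductSpace.laplacian_smul M contDiff_radialSinc.contDiffAt,
    laplacian_radialSinc] at hlap
  have h1 := heq z hzball
  have h2 : 0 < M * radialSinc κ z := mul_pos hMpos (hψpos z hz)
  rw [hφz] at h1
  simp only [smul_eq_mul] at hlap
  nlinarith

theorem isLeast_dirichletBallEigenvalues_three {b : ℝ} (hb : 0 < b) :
    IsLeast (dirichletBallEigenvalues 3 b) ((Real.pi / b) ^ 2) :=
  ⟨pi_div_sq_mem_dirichletBallEigenvalues hb,
    fun _ h => pi_div_sq_le_of_mem_dirichletBallEigenvalues hb h⟩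

theorem firstDirichletEigenvalue_three {b : ℝ} (hb : 0 < b) :
    firstDirichletEigenvalue 3 b = (Real.pi / b) ^ 2 :=
  (isLeast_dirichletBallEigenvalues_three hb).csInf_eq

/-! ### The trigonometric inequality behind the constant -/

theorem cos_lt_cos_of_mem_Ioo {d y : ℝ} (hd : 0 ≤ d) (hy : d < y) (hy' : y < 2 * Real.pi - d) :
    Real.cos y < Real.cos d := by
  rcases le_or_gt y Real.pi with h | h
  · exact Real.cos_lt_cos_of_nonneg_of_le_pi hd h hy
  · rw [← Real.cos_two_pi_sub y]
    exact Real.cos_lt_cos_of_nonneg_of_le_pi hd (by linarith) (by linarith)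

/-- For `y < π / 2`, divide by `cos y`: the line `y - d`, `d = β - sin β cos β`, is tangent at `β`
to the convex function `cos² β tan y`. This tangency dictates the choice of `d`. From `π / 2` on,
the signs suffice. -/
theorem sub_mul_cos_lt_cos_sq_mul_sin {β y : ℝ} (hβ : 0 < β) (hβ' : β < Real.pi / 2)
    (hy : 0 < y) (hy' : y ≤ Real.pi) (hne : y ≠ β) :
    (y - (β - Real.sin β * Real.cos β)) * Real.cos y < Real.cos β ^ 2 * Real.sin y := by
  have hπ := Real.pi_pos
  have hcβ : 0 < Real.cos β := Real.cos_pos_of_mem_Ioo ⟨by linarith, hβ'⟩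
  have hsβ : 0 < Real.sin β := Real.sin_pos_of_pos_of_lt_pi hβ (by linarith)
  rcases lt_or_ge y (Real.pi / 2) with hlt | hge
  · have hid : Real.cos β * Real.sin (y - β) - (y - β) * Real.cos y =
        Real.cos β ^ 2 * Real.sin y - (y - (β - Real.sin β * Real.cos β)) * Real.cos y := by
      rw [Real.sin_sub]
      ring
    suffices 0 < Real.cos β * Real.sin (y - β) - (y - β) * Real.cos y by linarith
    rcases hne.lt_or_gt with h | h
    · have h1 : Real.sin (β - y) < β - y := Real.sin_lt (by linarith)
      have h2 : Real.cos β < Real.cos y :=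
        Real.cos_lt_cos_of_nonneg_of_le_pi hy.le (by linarith) h
      have h3 : Real.sin (y - β) = -Real.sin (β - y) := by rw [← Real.sin_neg, neg_sub]
      rw [h3]
      nlinarith [mul_lt_mul_of_pos_left h1 hcβ, mul_lt_mul_of_pos_left h2 (sub_pos.2 h)]
    · have ht : 0 < y - β := sub_pos.2 h
      have hct : 0 < Real.cos (y - β) := Real.cos_pos_of_mem_Ioo ⟨by linarith, by linarith⟩
      have hst : 0 < Real.sin (y - β) := Real.sin_pos_of_pos_of_lt_pi ht (by linarith)
      have h1 : (y - β) * Real.cos (y - β) < Real.sin (y - β) := by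
        have := Real.lt_tan ht (by linarith)
        rwa [Real.tan_eq_sin_div_cos, lt_div_iff₀ hct] at this
      have h2 : Real.cos y = Real.cos (y - β) * Real.cos β - Real.sin (y - β) * Real.sin β := by
        rw [← Real.cos_add, sub_add_cancel]
      rw [h2]
      nlinarith [mul_lt_mul_of_pos_left h1 hcβ, mul_pos (mul_pos ht hst) hsβ]
  · have hc : Real.cos y ≤ 0 := Real.cos_nonpos_of_pi_div_two_le_of_le hge (by linarith)
    have hpos : 0 < y - (β - Real.sin β * Real.cos β) := by
      have := mul_pos hsβ hcβ
      linarith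
    rcases hy'.eq_or_lt with rfl | hlt
    · simp only [Real.cos_pi, Real.sin_pi]
      linarith
    · have := mul_pos (pow_pos hcβ 2) (Real.sin_pos_of_pos_of_lt_pi hy hlt)
      nlinarith

/-- With `y = 2 x + d`, the difference `Ψ` of the two sides vanishes at `x = 0`, and its derivative
is twice the gap in the tangent-line inequality. So `Ψ` increases up to `y = π`, in two pieces
because the derivative vanishes at `y = β`. Beyond, `sin y < 0` and `cos y < cos d`. -/
theorem two_mul_mul_sin_lt {β x : ℝ} (hβ : 0 < β) (hβ' : β < Real.pi / 2) (hx : 0 < x)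
    (hx' : x < Real.pi - (β - Real.sin β * Real.cos β)) :
    2 * x * Real.sin (2 * x + (β - Real.sin β * Real.cos β)) <
      (1 + Real.cos β ^ 2) * (Real.cos (β - Real.sin β * Real.cos β) -
        Real.cos (2 * x + (β - Real.sin β * Real.cos β))) := by
  have hπ := Real.pi_pos
  have hcβ : 0 < Real.cos β := Real.cos_pos_of_mem_Ioo ⟨by linarith, hβ'⟩
  have hsβ : 0 < Real.sin β := Real.sin_pos_of_pos_of_lt_pi hβ (by linarith)
  have hpoint := @sub_mul_cos_lt_cos_sq_mul_sin β
  set d := β - Real.sin β * Real.cos β with hd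
  have hd0 : 0 < d := by
    have h1 := Real.sin_lt hβ
    have h2 := mul_le_of_le_one_right hsβ.le (Real.cos_le_one β)
    linarith
  have hdβ : d < β := by
    have := mul_pos hsβ hcβ
    linarith
  set Ψ : ℝ → ℝ := fun x => (1 + Real.cos β ^ 2) * (Real.cos d - Real.cos (2 * x + d)) -
    2 * x * Real.sin (2 * x + d) with hΨ
  have hder : ∀ x, HasDerivAt Ψ
      (2 * (Real.cos β ^ 2 * Real.sin (2 * x + d) - (2 * x + d - d) * Real.cos (2 * x + d))) x := by
    intro x
    have hlin : HasDerivAt (fun x : ℝ => 2 * x + d) 2 x := by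
      simpa using ((hasDerivAt_id x).const_mul 2).add_const d
    have hlin' : HasDerivAt (fun x : ℝ => 2 * x) 2 x := by
      simpa using (hasDerivAt_id x).const_mul 2
    refine (((hlin.cos.const_sub (Real.cos d)).const_mul (1 + Real.cos β ^ 2)).sub
      (hlin'.mul hlin.sin)).congr_deriv ?_
    ring
  have hcont : Continuous Ψ := by fun_prop
  have hmono1 : StrictMonoOn Ψ (Icc 0 ((β - d) / 2)) := by
    refine strictMonoOn_of_deriv_pos (convex_Icc _ _) hcont.continuousOn fun x hx => ?_
    rw [interior_Icc] at hx
    rw [(hder x).deriv]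
    have := hpoint (y := 2 * x + d) hβ hβ' (by linarith [hx.1]) (by linarith [hx.2])
      (by linarith [hx.2] : 2 * x + d < β).ne
    linarith
  have hmono2 : StrictMonoOn Ψ (Icc ((β - d) / 2) ((Real.pi - d) / 2)) := by
    refine strictMonoOn_of_deriv_pos (convex_Icc _ _) hcont.continuousOn fun x hx => ?_
    rw [interior_Icc] at hx
    rw [(hder x).deriv]
    have := hpoint (y := 2 * x + d) hβ hβ' (by linarith [hx.1]) (by linarith [hx.2])
      (by linarith [hx.1] : β < 2 * x + d).ne'
    linarith
  have hΨ0 : Ψ 0 = 0 := by simp [hΨ]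
  have hpos1 : ∀ x, 0 < x → x ≤ (β - d) / 2 → 0 < Ψ x := fun x h h' => by
    rw [← hΨ0]
    exact hmono1 ⟨le_rfl, by linarith⟩ ⟨h.le, h'⟩ h
  rw [← sub_pos]
  change 0 < Ψ x
  rcases le_or_gt x ((β - d) / 2) with h | h
  · exact hpos1 x hx h
  rcases le_or_gt x ((Real.pi - d) / 2) with h' | h'
  · exact (hpos1 _ (by linarith) le_rfl).trans
      (hmono2 ⟨le_rfl, by linarith⟩ ⟨h.le, h'⟩ h)
  · have h1 : Real.cos (2 * x + d) < Real.cos d :=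
      cos_lt_cos_of_mem_Ioo hd0.le (by linarith) (by linarith)
    have h2 : Real.sin (2 * x + d) < 0 := by
      rw [← Real.sin_sub_two_pi]
      exact Real.sin_neg_of_neg_of_neg_pi_lt (by linarith) (by linarith)
    have h3 := mul_pos (add_pos one_pos (pow_pos hcβ 2)) (sub_pos.2 h1)
    have h4 := mul_neg_of_pos_of_neg hx h2
    simp only [hΨ]
    linarith

theorem cos_arccos_sqrt_sq {q : ℝ} (h0 : 0 ≤ q) (h1 : q ≤ 1) :
    Real.cos (Real.arccos √q) ^ 2 = q := by
  rw [Real.cos_arccos (by linarith [Real.sqrt_nonneg q]) (Real.sqrt_le_one.2 h1), Real.sq_sqrt h0]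

/-- Uses `arccos (-t) = π - arccos t` and `sin² β = 8 / (p + 3)`. -/
theorem ballConstant_eq {p : ℝ} (hp : 5 < p) :
    ballConstant p = Real.pi - (Real.arccos √((p - 5) / (p + 3)) -
      Real.sin (Real.arccos √((p - 5) / (p + 3))) * Real.cos (Real.arccos √((p - 5) / (p + 3)))) := by
  have hp3 : 0 < p + 3 := by linarith
  have hq0 : 0 ≤ (p - 5) / (p + 3) := div_nonneg (by linarith) hp3.le
  have hq1 : (p - 5) / (p + 3) ≤ 1 := (div_le_one hp3).2 (by linarith)
  have h1 : √(1 - (p - 5) / (p + 3)) * √((p - 5) / (p + 3)) = 2 * √(2 * (p - 5)) / (p + 3) := by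
    rw [← Real.sqrt_mul (by linarith)]
    refine (Real.sqrt_eq_iff_mul_self_eq (mul_nonneg (by linarith) hq0) (by positivity)).2 ?_
    have h2 := Real.mul_self_sqrt (show 0 ≤ 2 * (p - 5) by linarith)
    generalize √(2 * (p - 5)) = s at h2 ⊢
    field_simp
    linear_combination -4 * h2
  rw [Real.cos_arccos (by linarith [Real.sqrt_nonneg ((p - 5) / (p + 3))])
    (Real.sqrt_le_one.2 hq1), Real.sin_arccos, Real.sq_sqrt hq0, h1, ballConstant, Real.arccos_neg]
  ring

/-! ### Integral identities for positive solutions -/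

/-- The minorant `e` replaces a limit of `E` at `b`: there a term in `(v')²` need not vanish, but it
is nonnegative and can be dropped. -/
theorem false_of_deriv_neg_of_tendsto {E E' e : ℝ → ℝ} {b : ℝ} (hb : 0 < b)
    (hE : ∀ r ∈ Ioo 0 b, HasDerivAt E (E' r) r) (hE' : ∀ r ∈ Ioo 0 b, E' r < 0)
    (h0 : Tendsto E (𝓝[>] 0) (𝓝 0)) (he : ∀ r ∈ Ioo 0 b, e r ≤ E r)
    (hb0 : Tendsto e (𝓝[<] b) (𝓝 0)) : False := by
  have hanti : StrictAntiOn E (Ioo 0 b) := by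
    refine strictAntiOn_of_deriv_neg (convex_Ioo 0 b)
      (fun r hr => (hE r hr).continuousAt.continuousWithinAt) fun r hr => ?_
    rw [interior_Ioo] at hr
    rw [(hE r hr).deriv]
    exact hE' r hr
  have hle : E (b / 3) ≤ 0 := by
    refine ge_of_tendsto h0 ?_
    filter_upwards [Ioo_mem_nhdsGT (show (0 : ℝ) < b / 3 by linarith)] with r hr
    exact (hanti ⟨hr.1, by linarith [hr.2]⟩ ⟨by linarith, by linarith⟩ hr.2).le
  have hlt : E (b / 2) < E (b / 3) :=
    hanti ⟨by linarith, by linarith⟩ ⟨by linarith, by linarith⟩ (by linarith)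
  have hge : 0 ≤ E (b / 2) := by
    refine le_of_tendsto hb0 ?_
    filter_upwards [Ioo_mem_nhdsLT (show b / 2 < b by linarith)] with r hr
    have hr' : r ∈ Ioo 0 b := ⟨by linarith [hr.1], hr.2⟩
    exact (he r hr').trans (hanti ⟨by linarith, by linarith⟩ hr' hr.1).le
  linarith

namespace IsPositiveBallSolution

variable {p lam b : ℝ} {u : ℝ → ℝ}

theorem hasDerivAt (h : IsPositiveBallSolution 3 p lam b u) {r : ℝ} (hr : r ∈ Ioo 0 b) :
    HasDerivAt u (deriv u r) r :=
  ((h.contDiffOn.contDiffAt (isOpen_Ioo.mem_nhds hr)).differentiableAt (by norm_num)).hasDerivAt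

theorem hasDerivAt_mul_id (h : IsPositiveBallSolution 3 p lam b u) {r : ℝ} (hr : r ∈ Ioo 0 b) :
    HasDerivAt (fun r => r * u r) (u r + r * deriv u r) r :=
  ((hasDerivAt_id r).mul (h.hasDerivAt hr)).congr_deriv (by simp)

theorem hasDerivAt_deriv_mul_id (h : IsPositiveBallSolution 3 p lam b u) {r : ℝ}
    (hr : r ∈ Ioo 0 b) :
    HasDerivAt (fun r => u r + r * deriv u r) (-(r * (lam * u r + u r ^ p))) r := by
  have h2 : HasDerivAt (deriv u) (deriv (deriv u) r) r := by
    have h1 : ContDiffOn ℝ 1 (deriv u) (Ioo 0 b) :=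
      h.contDiffOn.deriv_of_isOpen isOpen_Ioo (by norm_num)
    exact ((h1.contDiffAt (isOpen_Ioo.mem_nhds hr)).differentiableAt (by norm_num)).hasDerivAt
  refine ((h.hasDerivAt hr).add ((hasDerivAt_id r).mul h2)).congr_deriv ?_
  have heq := h.equation r hr
  have hr0 := hr.1.ne'
  have : r * (((3 : ℕ) - 1 : ℝ) / r * deriv u r) = 2 * deriv u r := by
    push_cast
    field_simp
    ring
  simp only [id, one_mul]
  linear_combination r * heq - this

/-- The equation bounds `v''`, hence `v'`. Boundary terms can then be handled without limits of
`v'`: each is `v'` times a factor tending to `0`. -/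
theorem exists_abs_deriv_mul_id_le (h : IsPositiveBallSolution 3 p lam b u) (hp : 0 ≤ p)
    (hb : 0 < b) : ∃ M, ∀ r ∈ Ioo 0 b, |u r + r * deriv u r| ≤ M := by
  have hcont : ContinuousOn (fun r => -(r * (lam * u r + u r ^ p))) (Icc 0 b) :=
    (continuousOn_id.mul ((h.continuousOn.const_mul lam).add
      (h.continuousOn.rpow_const fun _ _ => Or.inr hp))).neg
  obtain ⟨K, hK⟩ := isCompact_Icc.exists_bound_of_continuousOn hcont
  have hm : b / 2 ∈ Ioo 0 b := ⟨by linarith, by linarith⟩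
  refine ⟨|u (b / 2) + b / 2 * deriv u (b / 2)| + K * b, fun r hr => ?_⟩
  have hmv := (convex_Ioo 0 b).norm_image_sub_le_of_norm_hasDerivWithin_le
    (fun x hx => (h.hasDerivAt_deriv_mul_id hx).hasDerivWithinAt)
    (fun x hx => hK x (Ioo_subset_Icc_self hx)) hm hr
  have hK0 : 0 ≤ K := (norm_nonneg _).trans (hK 0 ⟨le_rfl, hb.le⟩)
  have hd : ‖r - b / 2‖ ≤ b := by
    rw [Real.norm_eq_abs, abs_le]
    constructor <;> linarith [hr.1, hr.2]
  have h1 := hmv.trans (mul_le_mul_of_nonneg_left hd hK0)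
  rw [Real.norm_eq_abs] at h1
  have h2 := abs_sub_abs_le_abs_sub (u r + r * deriv u r) (u (b / 2) + b / 2 * deriv u (b / 2))
  linarith

theorem tendsto_zero (h : IsPositiveBallSolution 3 p lam b u) (hb : 0 < b) :
    Tendsto u (𝓝[>] 0) (𝓝 (u 0)) :=
  (h.continuousOn 0 ⟨le_rfl, hb.le⟩).mono_left
    ((nhdsWithin_Ioo_eq_nhdsGT hb).symm.le.trans (nhdsWithin_mono _ Ioo_subset_Icc_self))

theorem tendsto_right (h : IsPositiveBallSolution 3 p lam b u) (hb : 0 < b) :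
    Tendsto u (𝓝[<] b) (𝓝 0) := by
  have := h.continuousOn b ⟨hb.le, le_rfl⟩
  rw [ContinuousWithinAt, h.boundary] at this
  exact this.mono_left
    ((nhdsWithin_Ioo_eq_nhdsLT hb).symm.le.trans (nhdsWithin_mono _ Ioo_subset_Icc_self))

theorem isBoundedUnder_zero (h : IsPositiveBallSolution 3 p lam b u) (hp : 0 ≤ p) (hb : 0 < b) :
    IsBoundedUnder (· ≤ ·) (𝓝[>] 0) (norm ∘ fun r => u r + r * deriv u r) := by
  obtain ⟨M, hM⟩ := h.exists_abs_deriv_mul_id_le hp hb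
  exact isBoundedUnder_of_eventually_le (a := M) (mem_of_superset (Ioo_mem_nhdsGT hb) hM)

theorem isBoundedUnder_right (h : IsPositiveBallSolution 3 p lam b u) (hp : 0 ≤ p) (hb : 0 < b) :
    IsBoundedUnder (· ≤ ·) (𝓝[<] b) (norm ∘ fun r => u r + r * deriv u r) := by
  obtain ⟨M, hM⟩ := h.exists_abs_deriv_mul_id_le hp hb
  exact isBoundedUnder_of_eventually_le (a := M) (mem_of_superset (Ioo_mem_nhdsLT hb) hM)

theorem mul_lt_pi (h : IsPositiveBallSolution 3 p lam b u) (hp : 0 ≤ p) (hlam : 0 < lam)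
    (hb : 0 < b) : √lam * b < Real.pi := by
  by_contra! hge
  have hπ := Real.pi_pos
  set k := Real.pi / b with hk
  have hk0 : 0 < k := div_pos hπ hb
  have hkb : k * b = Real.pi := div_mul_cancel₀ _ hb.ne'
  have hklam : k ^ 2 ≤ lam := by
    have h1 : k ≤ √lam := (div_le_iff₀ hb).2 hge
    calc k ^ 2 ≤ √lam ^ 2 := pow_le_pow_left₀ hk0.le h1 2
      _ = lam := Real.sq_sqrt hlam.le
  set W : ℝ → ℝ := fun r => (u r + r * deriv u r) * Real.sin (k * r) -
    r * u r * (k * Real.cos (k * r)) with hW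
  have hlin : ∀ r, HasDerivAt (fun r : ℝ => k * r) k r := fun r => by
    simpa using (hasDerivAt_id r).const_mul k
  have hsin0 : Tendsto (fun r => Real.sin (k * r)) (𝓝[>] 0) (𝓝 0) := by
    have : Continuous fun r => Real.sin (k * r) := by fun_prop
    simpa using (this.tendsto 0).mono_left nhdsWithin_le_nhds
  have hsinb : Tendsto (fun r => Real.sin (k * r)) (𝓝[<] b) (𝓝 0) := by
    have : Continuous fun r => Real.sin (k * r) := by fun_prop
    simpa [hkb] using (this.tendsto b).mono_left nhdsWithin_le_nhds
  have hcos : Continuous fun r => k * Real.cos (k * r) := by fun_prop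
  refine false_of_deriv_neg_of_tendsto (E := W) (e := W) (E' := fun r =>
    (-(r * (lam * u r + u r ^ p)) + k ^ 2 * (r * u r)) * Real.sin (k * r)) hb ?_ ?_ ?_
    (fun _ _ => le_rfl) ?_
  · intro r hr
    refine (((h.hasDerivAt_deriv_mul_id hr).mul (hlin r).sin).sub
      ((h.hasDerivAt_mul_id hr).mul ((hlin r).cos.const_mul k))).congr_deriv ?_
    ring
  · intro r hr
    have hu := h.pos r hr
    have hs : 0 < Real.sin (k * r) := by
      refine Real.sin_pos_of_pos_of_lt_pi (mul_pos hk0 hr.1) ?_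
      rw [← hkb]
      exact mul_lt_mul_of_pos_left hr.2 hk0
    refine mul_neg_of_neg_of_pos ?_ hs
    have h1 : 0 < r * u r ^ p := mul_pos hr.1 (Real.rpow_pos_of_pos hu p)
    have h2 := mul_le_mul_of_nonneg_right hklam (mul_pos hr.1 hu).le
    linarith
  · have h1 := hsin0.zero_mul_isBoundedUnder_le (h.isBoundedUnder_zero hp hb)
    have h2 := ((tendsto_nhdsWithin_of_tendsto_nhds tendsto_id).mul (h.tendsto_zero hb)).mul
      ((hcos.tendsto 0).mono_left nhdsWithin_le_nhds)
    simpa [hW, mul_comm] using h1.sub h2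
  · have h1 := hsinb.zero_mul_isBoundedUnder_le (h.isBoundedUnder_right hp hb)
    have h2 := ((tendsto_nhdsWithin_of_tendsto_nhds tendsto_id).mul (h.tendsto_right hb)).mul
      ((hcos.tendsto b).mono_left nhdsWithin_le_nhds)
    simpa [hW, mul_comm] using h1.sub h2

/-- The derivative of the Pohozaev functional with multiplier `φ`, where `φ''' + 4 lam φ' = 0`. -/
theorem hasDerivAt_pohozaev (h : IsPositiveBallSolution 3 p lam b u) (hp : p + 1 ≠ 0)
    {φ φ₁ φ₂ : ℝ → ℝ} {r : ℝ} (hr : r ∈ Ioo 0 b) (hφ : HasDerivAt φ (φ₁ r) r)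
    (hφ₁ : HasDerivAt φ₁ (φ₂ r) r) (hφ₂ : HasDerivAt φ₂ (-(4 * lam * φ₁ r)) r) :
    HasDerivAt (fun r => φ r * ((u r + r * deriv u r) ^ 2 / 2 + lam * (r * u r) ^ 2 / 2 +
        r ^ 2 * u r ^ (p + 1) / (p + 1)) - φ₁ r * (r * u r * (u r + r * deriv u r)) / 2 +
        φ₂ r * (r * u r) ^ 2 / 4)
      (-(r * u r ^ (p + 1) / (2 * (p + 1)) *
        (2 * (p - 1) * φ r - (p + 3) * (r * φ₁ r)))) r := by
  have hu := h.pos r hr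
  have hv := h.hasDerivAt_mul_id hr
  have hw := h.hasDerivAt_deriv_mul_id hr
  have hpow := (h.hasDerivAt hr).rpow_const (p := p + 1) (Or.inl hu.ne')
  have hmain := ((hφ.mul ((((hw.pow 2).div_const 2).add (((hv.pow 2).const_mul lam).div_const 2)).add
    (((hasDerivAt_pow 2 r).mul hpow).div_const (p + 1)))).sub
    ((hφ₁.mul (hv.mul hw)).div_const 2)).add ((hφ₂.mul (hv.pow 2)).div_const 4)
  -- The `(v')²` and `v v'` terms cancel by the choice of coefficients, the `v²` terms by `φ''' = -4
  -- lam φ'`.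
  refine hmain.congr_deriv ?_
  simp only [Pi.add_apply, Pi.mul_apply, Pi.pow_apply, add_sub_cancel_right,
    Real.rpow_add_one hu.ne']
  field_simp
  ring

theorem ballConstant_lt (h : IsPositiveBallSolution 3 p lam b u) (hp : 5 < p) (hlam : 0 < lam)
    (hb : 0 < b) : ballConstant p < √lam * b := by
  by_contra! hle
  rw [ballConstant_eq hp] at hle
  have hπ := Real.pi_pos
  have hp3 : 0 < p + 3 := by linarith
  have hq0 : 0 < (p - 5) / (p + 3) := div_pos (by linarith) hp3
  have hq1 : (p - 5) / (p + 3) < 1 := (div_lt_one hp3).2 (by linarith)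
  have hβ : 0 < Real.arccos √((p - 5) / (p + 3)) :=
    Real.arccos_pos.2 ((Real.sqrt_lt' one_pos).2 (by simpa using hq1))
  have hβ' : Real.arccos √((p - 5) / (p + 3)) < Real.pi / 2 :=
    Real.arccos_lt_pi_div_two.2 (Real.sqrt_pos.2 hq0)
  have hcβ := cos_arccos_sqrt_sq hq0.le hq1.le
  set β := Real.arccos √((p - 5) / (p + 3))
  have hmult := @two_mul_mul_sin_lt β
  have hd0 : 0 ≤ β - Real.sin β * Real.cos β := by
    have h1 := Real.sin_lt hβ
    have h2 := mul_le_of_le_one_right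
      (Real.sin_pos_of_pos_of_lt_pi hβ (by linarith)).le (Real.cos_le_one β)
    linarith
  rw [hcβ] at hmult
  set d := β - Real.sin β * Real.cos β
  set κ := √lam
  have hκ : 0 < κ := Real.sqrt_pos.2 hlam
  have hκ2 : κ ^ 2 = lam := Real.sq_sqrt hlam.le
  set φ : ℝ → ℝ := fun r => Real.cos d - Real.cos (2 * (κ * r) + d) with hφ
  set φ₁ : ℝ → ℝ := fun r => 2 * κ * Real.sin (2 * (κ * r) + d) with hφ₁
  set φ₂ : ℝ → ℝ := fun r => 4 * lam * Real.cos (2 * (κ * r) + d) with hφ₂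
  have hlin : ∀ r, HasDerivAt (fun r : ℝ => 2 * (κ * r) + d) (2 * κ) r := fun r => by
    simpa using (((hasDerivAt_id r).const_mul κ).const_mul 2).add_const d
  have hφd : ∀ r, HasDerivAt φ (φ₁ r) r := fun r =>
    ((hlin r).cos.const_sub _).congr_deriv (by simp only [hφ₁]; ring)
  have hφ₁d : ∀ r, HasDerivAt φ₁ (φ₂ r) r := fun r =>
    ((hlin r).sin.const_mul (2 * κ)).congr_deriv (by simp only [hφ₂, ← hκ2]; ring)
  have hφ₂d : ∀ r, HasDerivAt φ₂ (-(4 * lam * φ₁ r)) r := fun r =>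
    ((hlin r).cos.const_mul (4 * lam)).congr_deriv (by simp only [hφ₁]; ring)
  have hφc : Continuous φ := continuous_iff_continuousAt.2 fun r => (hφd r).continuousAt
  have hφ₁c : Continuous φ₁ := continuous_iff_continuousAt.2 fun r => (hφ₁d r).continuousAt
  have hφ₂c : Continuous φ₂ := continuous_iff_continuousAt.2 fun r => (hφ₂d r).continuousAt
  have hlim : ∀ {f : ℝ → ℝ} {a : ℝ} {s : Set ℝ}, Continuous f →
      Tendsto f (𝓝[s] a) (𝓝 (f a)) := fun hf => (hf.tendsto _).mono_left nhdsWithin_le_nhds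
  have hx : ∀ r ∈ Ioo 0 b, 0 < κ * r ∧ κ * r < Real.pi - d := fun r hr =>
    ⟨mul_pos hκ hr.1, (mul_lt_mul_of_pos_left hr.2 hκ).trans_le hle⟩
  have hp1 : 0 < p + 1 := by linarith
  -- `e` omits `φ` times the energy, nonnegative because `2 κ r + d` stays in `(d, 2π - d)`.
  refine false_of_deriv_neg_of_tendsto (e := fun r =>
      -(φ₁ r * (r * u r * (u r + r * deriv u r)) / 2) + φ₂ r * (r * u r) ^ 2 / 4) hb
    (fun r hr => h.hasDerivAt_pohozaev hp1.ne' hr (hφd r) (hφ₁d r) (hφ₂d r)) ?_ ?_ ?_ ?_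
  · intro r hr
    have hu := Real.rpow_pos_of_pos (h.pos r hr) (p + 1)
    have hr0 := hr.1
    have h1 := hmult hβ hβ' (hx r hr).1 (hx r hr).2
    have h2 : (p + 3) * (r * φ₁ r) < 2 * (p - 1) * φ r := by
      have h3 := mul_lt_mul_of_pos_left h1 hp3
      -- `1 + cos² β = 2 (p - 1) / (p + 3)`, the ratio of the two coefficients in the Pohozaev
      -- derivative; this fixes `β`.
      have h4 : (p + 3) * (1 + (p - 5) / (p + 3)) = 2 * (p - 1) := by
        field_simp
        ring
      rw [← mul_assoc (p + 3) (1 + (p - 5) / (p + 3)), h4] at h3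
      refine lt_of_eq_of_lt ?_ h3
      simp only [hφ₁]
      ring
    rw [neg_lt_zero]
    exact mul_pos (by positivity) (sub_pos.2 h2)
  · have hid : Tendsto (fun r : ℝ => r) (𝓝[>] 0) (𝓝 0) := hlim continuous_id
    have hu := h.tendsto_zero hb
    have hw := h.isBoundedUnder_zero (by linarith) hb
    -- `φ 0 = 0` kills the energy term at the origin, where `v'` is only known to be bounded.
    have hφ0 : Tendsto φ (𝓝[>] 0) (𝓝 0) := by simpa [hφ] using hlim (a := 0) (s := Ioi 0) hφc
    have hv : Tendsto (fun r => r * u r) (𝓝[>] 0) (𝓝 0) := by simpa using hid.mul hu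
    have t1 := (hφ0.zero_mul_isBoundedUnder_le hw).zero_mul_isBoundedUnder_le hw
    have t2 := hφ0.mul (((hv.pow 2).const_mul lam).div_const 2)
    have t3 := hφ0.mul (((hid.pow 2).mul (hu.rpow_const (p := p + 1)
      (Or.inr hp1.le))).div_const (p + 1))
    have t4 := ((hlim (s := Ioi 0) hφ₁c).mul (hv.zero_mul_isBoundedUnder_le hw)).div_const 2
    have t5 := ((hlim (s := Ioi 0) hφ₂c).mul (hv.pow 2)).div_const 4
    have := (((t1.div_const 2).add (t2.add t3)).sub t4).add t5
    simp only [ne_eq, OfNat.ofNat_ne_zero, not_false_eq_true, zero_pow, mul_zero, zero_mul,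
      zero_div, add_zero, sub_zero] at this
    refine this.congr fun r => ?_
    ring
  · intro r hr
    have hu := Real.rpow_pos_of_pos (h.pos r hr) (p + 1)
    have hφr : 0 ≤ φ r := by
      have := hx r hr
      exact (sub_pos.2 (cos_lt_cos_of_mem_Ioo hd0 (by linarith) (by linarith))).le
    have : 0 ≤ φ r * ((u r + r * deriv u r) ^ 2 / 2 + lam * (r * u r) ^ 2 / 2 +
        r ^ 2 * u r ^ (p + 1) / (p + 1)) := by positivity
    linarith
  · have hid : Tendsto (fun r : ℝ => r) (𝓝[<] b) (𝓝 b) := hlim continuous_id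
    have hw := h.isBoundedUnder_right (by linarith) hb
    have hv : Tendsto (fun r => r * u r) (𝓝[<] b) (𝓝 0) := by
      simpa using hid.mul (h.tendsto_right hb)
    have t4 := ((hlim (s := Iio b) hφ₁c).mul (hv.zero_mul_isBoundedUnder_le hw)).div_const 2
    have t5 := ((hlim (s := Iio b) hφ₂c).mul (hv.pow 2)).div_const 4
    simpa using t4.neg.add t5

end IsPositiveBallSolution

/-! ### Equivalence of the two forms and conclusion -/

theorem ballConstant_nonneg {p : ℝ} (hp : 5 < p) : 0 ≤ ballConstant p := by
  have : 0 < p + 3 := by linarith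
  exact add_nonneg (by positivity) (Real.arccos_nonneg _)

theorem radius_bounds_iff_eigenvalue_bounds {C lam b : ℝ} (hC : 0 ≤ C) (hlam : 0 < lam)
    (hb : 0 < b) :
    (1 / √lam * C < b ∧ b < Real.pi / √lam) ↔
      (1 / Real.pi ^ 2 * C ^ 2 * (Real.pi / b) ^ 2 < lam ∧ lam < (Real.pi / b) ^ 2) := by
  have hπ := Real.pi_pos
  have hs : 0 < √lam := Real.sqrt_pos.2 hlam
  have hs2 : √lam ^ 2 = lam := Real.sq_sqrt hlam.le
  refine and_congr ?_ ?_
  · have h1 : 1 / Real.pi ^ 2 * C ^ 2 * (Real.pi / b) ^ 2 = (C / b) ^ 2 := by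
      field_simp
    rw [h1, one_div_mul_eq_div, div_lt_iff₀ hs]
    conv_rhs => rw [← hs2]
    rw [pow_lt_pow_iff_left₀ (by positivity) hs.le two_ne_zero, div_lt_iff₀ hb, mul_comm]
  · conv_rhs => rw [← hs2]
    rw [pow_lt_pow_iff_left₀ hs.le (by positivity) two_ne_zero, lt_div_iff₀ hs, lt_div_iff₀ hb,
      mul_comm]

theorem corollary1p8 (p lam b : ℝ) (hp : 5 < p) (hlam : 0 < lam) (hb : 0 < b) :
    -- the first eigenvalue is attained: it is the least eigenvalue
    IsLeast (dirichletBallEigenvalues 3 b) (firstDirichletEigenvalue 3 b) ∧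
    -- necessary conditions for a positive solution, in both forms
    ((∃ u : ℝ → ℝ, IsPositiveBallSolution 3 p lam b u) →
      (1 / √lam * ballConstant p < b ∧ b < Real.pi / √lam) ∧
      (1 / Real.pi ^ 2 * ballConstant p ^ 2 * firstDirichletEigenvalue 3 b < lam ∧
        lam < firstDirichletEigenvalue 3 b)) ∧
    -- the two forms are equivalent
    ((1 / √lam * ballConstant p < b ∧ b < Real.pi / √lam) ↔
      (1 / Real.pi ^ 2 * ballConstant p ^ 2 * firstDirichletEigenvalue 3 b < lam ∧
        lam < firstDirichletEigenvalue 3 b)) := by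
  rw [firstDirichletEigenvalue_three hb]
  have hiff := radius_bounds_iff_eigenvalue_bounds (ballConstant_nonneg hp) hlam hb
  refine ⟨isLeast_dirichletBallEigenvalues_three hb, ?_, hiff⟩
  rintro ⟨u, hu⟩
  have hs : 0 < √lam := Real.sqrt_pos.2 hlam
  have hbounds : 1 / √lam * ballConstant p < b ∧ b < Real.pi / √lam := by
    rw [one_div_mul_eq_div, div_lt_iff₀ hs, lt_div_iff₀ hs, mul_comm b]
    exact ⟨hu.ballConstant_lt hp hlam hb, hu.mul_lt_pi (by linarith) hlam hb⟩
  exact ⟨hbounds, hiff.1 hbounds⟩
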